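/- **Definitions.** Let $A,B$ be boolean algebras. A *subordination* is a relation $S\subseteq A\times B$ such that $0\mathrel S0$ and $1\mathrel S1$; $a\mathrel Sc$ and $b\mathrel Sc$ imply $(a\vee b)\mathrel Sc$; $a\mathrel Sc$ and $a\mathrel Sd$ imply $a\mathrel S(c\wedge d)$; and $a\le b\mathrel Sc\le d$ implies $a\mathrel Sd$. An *$\mathsf{S5}$-subordination algebra* is a pair $\mathbf B=(B,S)$ where $S$ is a subordination on the boolean algebra $B$ (from $B$ to $B$) such that $a\mathrel Sb$ implies $a\le b$; $a\mathrel Sb$ implies $\neg b\mathrel S\neg a$; and $a\mathrel Sb$ implies $a\mathrel Sc\mathrel Sb$ for some $c\in B$. It is a *de Vries algebra* if, moreover, $B$ is complete and for every $a\ne0$ there is $b\ne0$ with $b\mathrel Sa$. $\mathsf{SubS5^S}$ is the category whose objects are the $\mathsf{S5}$-subordination algebras and whose morphisms $(B_1,S_1)\to(B_2,S_2)$ are the subordinations $T\subseteq B_1\times B_2$ that are *compatible*, i.e. $S_2\circ T=T=T\circ S_1$. Composition is composition of relations and the identity of $(B,S)$ is $S$. $\mathsf{DeV^S}$ is its full subcategory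 of de Vries algebras, and $\Delta\colon\mathsf{DeV^S}\to\mathsf{SubS5^S}$ is the inclusion functor. In a frame $L$ let $a^*$ be the pseudocomplement of $a$ and write $a\prec b$ if $a^*\vee b=1$. $L$ is *compact* if $1$ is a compact element and *regular* if $a=\bigvee\{x\in L\mid x\prec a\}$ for all $a\in L$. $\mathsf{KRFrm^P}$ is the category of compact regular frames and maps that preserve finite meets and directed joins. A *round ideal* of $\mathbf B=(B,S)$ is an ideal $I$ of $B$ such that every $a\in I$ satisfies $a\mathrel Sb$ for some $b\in I$. The contravariant functor $\mathcal{RI}\colon\mathsf{SubS5^S}\to\mathsf{KRFrm^P}$ sends $\mathbf B$ to the frame of its round ideals ordered by inclusion and $T\colon\mathbf B_1\to\mathbf B_2$ to the map $I\mapsto T^{-1}[I]=\{a\mid a\mathrel Tb\text{ for some }b\in I\}$. The contravariant functor $\mathfrak B\colon\mathsf{KRFrm^P}\to\mathsf{DeV^S}$ sends $L$ to the boolean algebra $\mathfrak BL=\{a\in L\mid a=a^{**}\}$ (with the order of $L$) equipped with the restriction of $\prec$, and $\Box\colon L\to M$ to the relation $\mathfrak B(\Box)\colon\mathfrak BM\to\mathfrak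 BL$ given by $b\mathrel{\mathfrak B(\Box)}a$ iff $b\prec\Box a$. Let $\mathcal{NI}=\mathfrak B\circ\mathcal{RI}\colon\mathsf{SubS5^S}\to\mathsf{DeV^S}$ (the *MacNeille completion functor*). For an $\mathsf{S5}$-subordination algebra $\mathbf B$ let $Q_{\mathbf B}\colon\mathbf B\to\mathcal{NI}(\mathbf B)$ be the relation given by $a\mathrel{Q_{\mathbf B}}I$ iff $a\in I$. **Theorem.** The functors $\mathcal{NI}\colon\mathsf{SubS5^S}\to\mathsf{DeV^S}$ and $\Delta\colon\mathsf{DeV^S}\to\mathsf{SubS5^S}$ are quasi-inverses of each other. Precisely: the relations $Q_{\mathbf B}$ ($\mathbf B\in\mathsf{SubS5^S}$) are the components of a natural isomorphism $1_{\mathsf{SubS5^S}}\to\Delta\circ\mathcal{NI}$, and the relations $Q_{\mathbf B}$ ($\mathbf B\in\mathsf{DeV^S}$) are the components of a natural isomorphism $1_{\mathsf{DeV^S}}\to\mathcal{NI}\circ\Delta$. Thus $\mathsf{SubS5^S}$ and $\mathsf{DeV^S}$ are equivalent, by an equivalence consisting of $\mathcal{NI}$ and $\Delta$. -/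

import Mathlib

open CategoryTheory Opposite

universe u

namespace SubordinationAlgebra

/-! ### Subordinations -/

/-- A subordination relation between boolean algebras. -/
structure IsSubordination {A B : Type*} [BooleanAlgebra A] [BooleanAlgebra B]
    (S : A → B → Prop) : Prop where
  bot_bot : S ⊥ ⊥
  top_top : S ⊤ ⊤
  sup_left : ∀ {a b c}, S a c → S b c → S (a ⊔ b) c
  inf_right : ∀ {a c d}, S a c → S a d → S a (c ⊓ d)
  mono : ∀ {a b c d}, a ≤ b → S b c → c ≤ d → S a d

/-- An S5-subordination on a boolean algebra. -/
structure IsS5Subordination {B : Type*} [BooleanAlgebra B] (S : B → B → Prop) : Prop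
    extends IsSubordination S where
  le_of_rel : ∀ {a b}, S a b → a ≤ b
  compl : ∀ {a b}, S a b → S bᶜ aᶜ
  dense : ∀ {a b}, S a b → ∃ c, S a c ∧ S c b

/-- S5-subordination algebras. -/
structure SubS5 : Type (u + 1) where
  carrier : Type u
  [str : BooleanAlgebra carrier]
  rel : carrier → carrier → Prop
  isS5 : IsS5Subordination rel

attribute [instance] SubS5.str

/-- Compatible subordinations `T : B₁ → B₂`: subordinations with `S₂ ∘ T = T = T ∘ S₁`.
(`Relation.Comp R R'` is the relational composition `R' ∘ R`.) -/
@[ext]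
structure SubS5.Hom (B₁ B₂ : SubS5.{u}) : Type u where
  rel : B₁.carrier → B₂.carrier → Prop
  isSub : IsSubordination rel
  comp_right : Relation.Comp rel B₂.rel = rel
  comp_left : Relation.Comp B₁.rel rel = rel

theorem IsS5Subordination.comp_self {B : Type*} [BooleanAlgebra B] {S : B → B → Prop}
    (h : IsS5Subordination S) : Relation.Comp S S = S := by
  funext a b
  apply propext
  constructor
  · rintro ⟨c, hac, hcb⟩
    exact h.mono (h.le_of_rel hac) hcb le_rfl
  · exact h.dense

theorem IsSubordination.comp {A B C : Type*} [BooleanAlgebra A] [BooleanAlgebra B]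
    [BooleanAlgebra C] {S : A → B → Prop} {T : B → C → Prop}
    (hS : IsSubordination S) (hT : IsSubordination T) :
    IsSubordination (Relation.Comp S T) where
  bot_bot := ⟨⊥, hS.bot_bot, hT.bot_bot⟩
  top_top := ⟨⊤, hS.top_top, hT.top_top⟩
  sup_left := by
    rintro a b c ⟨x, hx, hx'⟩ ⟨y, hy, hy'⟩
    exact ⟨x ⊔ y, hS.sup_left (hS.mono le_rfl hx le_sup_left) (hS.mono le_rfl hy le_sup_right),
      hT.sup_left hx' hy'⟩
  inf_right := by
    rintro a c d ⟨x, hx, hx'⟩ ⟨y, hy, hy'⟩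
    exact ⟨x ⊓ y, hS.inf_right hx hy,
      hT.inf_right (hT.mono inf_le_left hx' le_rfl) (hT.mono inf_le_right hy' le_rfl)⟩
  mono := by
    rintro a b c d hab ⟨x, hx, hx'⟩ hcd
    exact ⟨x, hS.mono hab hx le_rfl, hT.mono le_rfl hx' hcd⟩

/-- The category of S5-subordination algebras and compatible subordinations: composition is
composition of relations, and the identity of `(B, S)` is `S`. -/
instance : Category SubS5.{u} where
  Hom := SubS5.Hom
  id B := ⟨B.rel, B.isS5.toIsSubordination, B.isS5.comp_self, B.isS5.comp_self⟩
  comp {_ _ _} T T' :=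
    { rel := Relation.Comp T.rel T'.rel
      isSub := T.isSub.comp T'.isSub
      comp_right := by rw [Relation.comp_assoc, T'.comp_right]
      comp_left := by rw [← Relation.comp_assoc, T.comp_left] }
  id_comp T := SubS5.Hom.ext T.comp_left
  comp_id T := SubS5.Hom.ext T.comp_right
  assoc _ _ _ := SubS5.Hom.ext Relation.comp_assoc

/-- The object property of being a de Vries algebra: the boolean algebra is complete and every
nonzero `a` has a nonzero `b` with `b S a`. -/
def IsDeVries : ObjectProperty SubS5.{u} := fun B =>
  (∀ s : Set B.carrier, ∃ x, IsLUB s x) ∧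
    ∀ a : B.carrier, a ≠ ⊥ → ∃ b, b ≠ ⊥ ∧ B.rel b a

/-- The full subcategory of de Vries algebras. -/
abbrev DeVS : Type (u + 1) := IsDeVries.{u}.FullSubcategory

/-- The inclusion functor `Δ`. -/
abbrev Δ : DeVS.{u} ⥤ SubS5.{u} := IsDeVries.{u}.ι

/-! ### Compact regular frames and preframe homomorphisms -/

/-- The well-inside relation of a frame. -/
def WellInside {L : Type*} [Order.Frame L] (a b : L) : Prop := aᶜ ⊔ b = ⊤

/-- Compact regular frames. -/
structure KRFrmP : Type (u + 1) where
  carrier : Type u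
  [str : Order.Frame carrier]
  compact : IsCompactElement (⊤ : carrier)
  regular : ∀ a : carrier, a = sSup {x | WellInside x a}

attribute [instance] KRFrmP.str

/-- Preframe homomorphisms: maps preserving finite meets and directed joins. -/
@[ext]
structure PreframeHom (L M : Type u) [Order.Frame L] [Order.Frame M] : Type u where
  toFun : L → M
  map_top : toFun ⊤ = ⊤
  map_inf : ∀ a b, toFun (a ⊓ b) = toFun a ⊓ toFun b
  map_sSup : ∀ s : Set L, s.Nonempty → DirectedOn (· ≤ ·) s →
    toFun (sSup s) = sSup (toFun '' s)

theorem PreframeHom.monotone {L M : Type u} [Order.Frame L] [Order.Frame M]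
    (f : PreframeHom L M) : Monotone f.toFun := fun a b hab => by
  have := f.map_inf a b
  rw [inf_eq_left.2 hab] at this
  exact inf_eq_left.1 this.symm

/-- The category of compact regular frames and preframe homomorphisms. -/
instance : Category KRFrmP.{u} where
  Hom L M := PreframeHom L.carrier M.carrier
  id L := ⟨id, rfl, fun _ _ => rfl, fun s _ _ => by simp⟩
  comp {_ _ _} f g :=
    { toFun := g.toFun ∘ f.toFun
      map_top := by simp [f.map_top, g.map_top]
      map_inf := fun a b => by simp [f.map_inf, g.map_inf]
      map_sSup := fun s hs hd => by
        have hmono := f.monotone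
        have hd' : DirectedOn (· ≤ ·) (f.toFun '' s) := by
          rintro _ ⟨x, hx, rfl⟩ _ ⟨y, hy, rfl⟩
          obtain ⟨z, hz, hxz, hyz⟩ := hd x hx y hy
          exact ⟨_, ⟨z, hz, rfl⟩, hmono hxz, hmono hyz⟩
        simp only [Function.comp_apply]
        rw [f.map_sSup s hs hd, g.map_sSup _ (hs.image _) hd', Set.image_image] }

/-! ### Round ideals -/

/-- Round ideals of an S5-subordination algebra. -/
structure RoundIdeal (B : SubS5.{u}) : Type u where
  ideal : Order.Ideal B.carrier
  round : ∀ a ∈ ideal, ∃ b ∈ ideal, B.rel a b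

namespace RoundIdeal

variable {B B₁ B₂ : SubS5.{u}}

instance : Membership B.carrier (RoundIdeal B) := ⟨fun I a => a ∈ I.ideal⟩

theorem mem_def {I : RoundIdeal B} {a : B.carrier} : a ∈ I ↔ a ∈ I.ideal := Iff.rfl

theorem ideal_injective : Function.Injective (ideal : RoundIdeal B → _) := by
  rintro ⟨I, hI⟩ ⟨J, hJ⟩ h
  cases h
  rfl

/-- Round ideals are ordered by inclusion. -/
instance : PartialOrder (RoundIdeal B) := PartialOrder.lift ideal ideal_injective

theorem le_def {I J : RoundIdeal B} : I ≤ J ↔ ∀ a ∈ I, a ∈ J := Iff.rfl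

theorem ext {I J : RoundIdeal B} (h : ∀ a, a ∈ I ↔ a ∈ J) : I = J :=
  le_antisymm (fun a ha => (h a).1 ha) (fun a ha => (h a).2 ha)

theorem lower {I : RoundIdeal B} {a b : B.carrier} (h : a ≤ b) (hb : b ∈ I) : a ∈ I :=
  I.ideal.lower h hb

theorem sup_mem {I : RoundIdeal B} {a b : B.carrier} (ha : a ∈ I) (hb : b ∈ I) :
    a ⊔ b ∈ I := Order.Ideal.sup_mem ha hb

theorem bot_mem (I : RoundIdeal B) : (⊥ : B.carrier) ∈ I := Order.Ideal.bot_mem _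

/-- An ideal from a set containing `⊥` and closed under lower elements and binary joins. -/
def mkIdeal {P : Type*} [BooleanAlgebra P] (s : Set P) (h0 : ⊥ ∈ s)
    (hl : ∀ a b, a ≤ b → b ∈ s → a ∈ s) (hs : ∀ a ∈ s, ∀ b ∈ s, a ⊔ b ∈ s) :
    Order.Ideal P where
  carrier := s
  lower' := fun a b hab ha => hl b a hab ha
  nonempty' := ⟨⊥, h0⟩
  directed' := fun a ha b hb => ⟨a ⊔ b, hs a ha b hb, le_sup_left, le_sup_right⟩

/-- The ideal `T⁻¹[K]`, for a subordination `T` and an ideal `K`. -/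
def preimageIdeal {T : B₁.carrier → B₂.carrier → Prop} (hT : IsSubordination T)
    (K : Order.Ideal B₂.carrier) : Order.Ideal B₁.carrier :=
  mkIdeal {a | ∃ b ∈ K, T a b} ⟨⊥, Order.Ideal.bot_mem _, hT.bot_bot⟩
    (fun _ _ h ⟨c, hc, hbc⟩ => ⟨c, hc, hT.mono h hbc le_rfl⟩)
    (fun _ ⟨c, hc, hac⟩ _ ⟨d, hd, hbd⟩ => ⟨c ⊔ d, Order.Ideal.sup_mem hc hd,
      hT.sup_left (hT.mono le_rfl hac le_sup_left) (hT.mono le_rfl hbd le_sup_right)⟩)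

/-- The join of a set of round ideals is the ideal generated by their union. -/
instance : SupSet (RoundIdeal B) where
  sSup s :=
    { ideal := sSup (ideal '' s)
      round := by
        have h : sSup (ideal '' s) ≤
            preimageIdeal B.isS5.toIsSubordination (sSup (ideal '' s)) := by
          apply sSup_le
          rintro _ ⟨I, hI, rfl⟩ a ha
          obtain ⟨b, hb, hab⟩ := I.round a ha
          exact ⟨b, (le_sSup (Set.mem_image_of_mem ideal hI) : _) hb, hab⟩
        exact fun _ ha => h ha }

theorem isLUB_sSup' (s : Set (RoundIdeal B)) : IsLUB s (sSup s) := by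
  constructor
  · intro I hI
    exact (le_sSup (Set.mem_image_of_mem ideal hI) : I.ideal ≤ _)
  · intro J hJ
    apply (sSup_le _ : sSup (ideal '' s) ≤ J.ideal)
    rintro _ ⟨I, hI, rfl⟩
    exact hJ hI

/-- The binary meet of round ideals is their intersection. -/
instance : Min (RoundIdeal B) where
  min I J :=
    { ideal := I.ideal ⊓ J.ideal
      round := by
        rintro a ⟨hI, hJ⟩
        obtain ⟨b, hb, hab⟩ := I.round a hI
        obtain ⟨c, hc, hac⟩ := J.round a hJ
        exact ⟨b ⊓ c, ⟨I.ideal.lower inf_le_left hb, J.ideal.lower inf_le_right hc⟩,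
          B.isS5.inf_right hab hac⟩ }

theorem mem_inf {I J : RoundIdeal B} {a : B.carrier} : a ∈ I ⊓ J ↔ a ∈ I ∧ a ∈ J := Iff.rfl

instance : Top (RoundIdeal B) where
  top := ⟨⊤, fun _ _ => ⟨⊤, trivial, B.isS5.mono le_top B.isS5.top_top le_rfl⟩⟩

theorem mem_top (a : B.carrier) : a ∈ (⊤ : RoundIdeal B) := trivial

instance : CompleteLattice (RoundIdeal B) where
  __ := completeLatticeOfSup (RoundIdeal B) isLUB_sSup'
  inf := (· ⊓ ·)
  inf_le_left _ _ := fun _ h => h.1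
  inf_le_right _ _ := fun _ h => h.2
  le_inf _ _ _ h h' := fun _ ha => ⟨h ha, h' ha⟩
  top := ⊤
  le_top _ := fun _ _ => trivial

theorem frame_aux (I : RoundIdeal B) (s : Set (RoundIdeal B)) :
    I ⊓ sSup s ≤ ⨆ J ∈ s, I ⊓ J := by
  set M : RoundIdeal B := ⨆ J ∈ s, I ⊓ J with hM
  let K : Order.Ideal B.carrier := mkIdeal {x | ∀ y ∈ I, x ⊓ y ∈ M}
    (fun y _ => by simpa using M.bot_mem)
    (fun a b hab hb y hy => lower (inf_le_inf_right y hab) (hb y hy))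
    (fun a ha b hb y hy => by
      rw [inf_sup_right]
      exact sup_mem (ha y hy) (hb y hy))
  have hK : sSup (ideal '' s) ≤ K := by
    apply sSup_le
    rintro _ ⟨J, hJ, rfl⟩ x hx y hy
    have hle : I ⊓ J ≤ M := le_iSup₂_of_le J hJ le_rfl
    exact hle ⟨lower inf_le_right hy, lower inf_le_left (mem_def.2 hx)⟩
  rintro a ⟨haI, haS⟩
  have h : a ⊓ a ∈ M := hK haS a haI
  rwa [inf_idem] at h

/-- The frame of round ideals, ordered by inclusion. -/
instance : Order.Frame (RoundIdeal B) := Order.Frame.ofMinimalAxioms ⟨frame_aux⟩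

theorem mem_sSup_of_directed {s : Set (RoundIdeal B)} (hs : s.Nonempty)
    (hd : DirectedOn (· ≤ ·) s) {a : B.carrier} : a ∈ sSup s ↔ ∃ I ∈ s, a ∈ I := by
  constructor
  · let K : Order.Ideal B.carrier := mkIdeal {x | ∃ I ∈ s, x ∈ I}
      (let ⟨I, hI⟩ := hs; ⟨I, hI, I.bot_mem⟩)
      (fun _ _ hab ⟨I, hI, hb⟩ => ⟨I, hI, lower hab hb⟩)
      (fun _ ⟨I, hI, ha⟩ _ ⟨J, hJ, hb⟩ => by
        obtain ⟨M, hM, hIM, hJM⟩ := hd I hI J hJ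
        exact ⟨M, hM, sup_mem (hIM ha) (hJM hb)⟩)
    have hK : sSup (ideal '' s) ≤ K := by
      apply sSup_le
      rintro _ ⟨J, hJ, rfl⟩ x hx
      exact ⟨J, hJ, hx⟩
    exact fun h => hK h
  · rintro ⟨I, hI, ha⟩
    exact (le_sSup hI : I ≤ sSup s) ha

theorem compact_top : IsCompactElement (⊤ : RoundIdeal B) := by
  intro s u hs hd hu htop
  rw [hu.unique (isLUB_sSup s)] at htop
  obtain ⟨I, hI, h⟩ := (mem_sSup_of_directed hs hd).1 (htop (mem_top ⊤))
  exact ⟨I, hI, fun a _ => lower le_top h⟩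

/-- The round ideal `T⁻¹[I]`, for a compatible subordination `T` and a round ideal `I`. -/
def preimage (T : B₁ ⟶ B₂) (I : RoundIdeal B₂) : RoundIdeal B₁ where
  ideal := preimageIdeal T.isSub I.ideal
  round := by
    rintro a ⟨b, hb, hab⟩
    rw [← T.comp_left] at hab
    obtain ⟨c, hac, hcb⟩ := hab
    exact ⟨c, ⟨b, hb, hcb⟩, hac⟩

theorem mem_preimage {T : B₁ ⟶ B₂} {I : RoundIdeal B₂} {a : B₁.carrier} :
    a ∈ preimage T I ↔ ∃ b ∈ I, T.rel a b := Iff.rfl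

theorem regular (J : RoundIdeal B) : J = sSup {I | WellInside I J} := by
  apply le_antisymm
  · intro a ha
    obtain ⟨b, hb, hab⟩ := J.round a ha
    obtain ⟨c, hc, hbc⟩ := J.round b hb
    let down : B.carrier → RoundIdeal B := fun x =>
      { ideal := preimageIdeal B.isS5.toIsSubordination (Order.Ideal.principal x)
        round := by
          rintro y ⟨z, hz, hyz⟩
          obtain ⟨w, hyw, hwz⟩ := B.isS5.dense hyz
          exact ⟨w, ⟨z, hz, hwz⟩, hyw⟩ }
    have hdown : ∀ x, ∀ y ∈ down x, y ≤ x := by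
      rintro x y ⟨z, hz, hyz⟩
      exact (B.isS5.le_of_rel hyz).trans hz
    have hI : WellInside (down b) J := by
      have h1 : down bᶜ ≤ (down b)ᶜ := by
        rw [le_compl_iff_disjoint_right, disjoint_iff_inf_le]
        rintro y ⟨hy, hy'⟩
        have h : y ≤ ⊥ := by
          rw [← inf_compl_eq_bot (a := b)]
          exact le_inf (hdown _ _ hy') (hdown _ _ hy)
        exact lower h (bot_mem _)
      rw [WellInside, eq_top_iff]
      intro x _
      have hc1 : cᶜ ∈ (down b)ᶜ ⊔ J :=
        (le_sup_left : _ ≤ (down b)ᶜ ⊔ J) (h1 ⟨bᶜ, le_refl (bᶜ), B.isS5.compl hbc⟩)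
      have hc2 : c ∈ (down b)ᶜ ⊔ J := (le_sup_right : J ≤ (down b)ᶜ ⊔ J) hc
      exact lower (le_top.trans (compl_sup_eq_top (x := c)).ge) (sup_mem hc1 hc2)
    have hle : down b ≤ sSup {I | WellInside I J} := le_sSup hI
    exact hle ⟨b, le_refl b, hab⟩
  · apply sSup_le
    intro I hI
    have h : I = I ⊓ J := by
      have := congrArg (I ⊓ ·) (show Iᶜ ⊔ J = ⊤ from hI)
      simpa [inf_sup_left] using this.symm
    rw [h]
    exact inf_le_right

end RoundIdeal

/-- The contravariant round ideal functor: `B ↦ RI(B)` and `T ↦ (I ↦ T⁻¹[I])`. -/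
def RI : SubS5.{u} ⥤ KRFrmP.{u}ᵒᵖ where
  obj B := op ⟨RoundIdeal B, RoundIdeal.compact_top, RoundIdeal.regular⟩
  map {B₁ B₂} T := Quiver.Hom.op
    ({ toFun := RoundIdeal.preimage T
       map_top := RoundIdeal.ext fun a =>
         ⟨fun _ => trivial, fun _ => ⟨⊤, trivial, T.isSub.mono le_top T.isSub.top_top le_rfl⟩⟩
       map_inf := fun I J => RoundIdeal.ext fun a => by
         constructor
         · rintro ⟨b, ⟨hI, hJ⟩, hab⟩
           exact ⟨⟨b, hI, hab⟩, ⟨b, hJ, hab⟩⟩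
         · rintro ⟨⟨b, hb, hab⟩, ⟨c, hc, hac⟩⟩
           exact ⟨b ⊓ c, ⟨I.ideal.lower inf_le_left hb, J.ideal.lower inf_le_right hc⟩,
             T.isSub.inf_right hab hac⟩
       map_sSup := fun s hs hd => RoundIdeal.ext fun a => by
         have hd' : DirectedOn (· ≤ ·) (RoundIdeal.preimage T '' s) := by
           rintro _ ⟨I, hI, rfl⟩ _ ⟨J, hJ, rfl⟩
           obtain ⟨M, hM, hIM, hJM⟩ := hd I hI J hJ
           exact ⟨_, ⟨M, hM, rfl⟩, fun x ⟨y, hy, hxy⟩ => ⟨y, hIM hy, hxy⟩,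
             fun x ⟨y, hy, hxy⟩ => ⟨y, hJM hy, hxy⟩⟩
         rw [RoundIdeal.mem_sSup_of_directed (hs.image _) hd', RoundIdeal.mem_preimage]
         simp only [RoundIdeal.mem_sSup_of_directed hs hd, Set.exists_mem_image,
           RoundIdeal.mem_preimage]
         constructor
         · rintro ⟨b, ⟨I, hI, hb⟩, hab⟩
           exact ⟨I, hI, b, hb, hab⟩
         · rintro ⟨I, hI, b, hb, hab⟩
           exact ⟨b, ⟨I, hI, hb⟩, hab⟩ } :
      PreframeHom (RoundIdeal B₂) (RoundIdeal B₁))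
  map_id B := by
    apply Quiver.Hom.unop_inj
    apply PreframeHom.ext
    funext I
    apply RoundIdeal.ext
    intro a
    constructor
    · rintro ⟨b, hb, hab⟩
      exact RoundIdeal.lower (B.isS5.le_of_rel hab) (RoundIdeal.mem_def.2 hb)
    · exact fun ha => I.round a ha
  map_comp {B₁ B₂ B₃} T T' := by
    apply Quiver.Hom.unop_inj
    apply PreframeHom.ext
    funext I
    apply RoundIdeal.ext
    intro a
    constructor
    · rintro ⟨c, hc, b, hab, hbc⟩
      exact ⟨b, ⟨c, hc, hbc⟩, hab⟩
    · rintro ⟨b, ⟨c, hc, hbc⟩, hab⟩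
      exact ⟨c, hc, b, hab, hbc⟩

/-! ### Booleanization -/

section WellInside

variable {L : Type*} [Order.Frame L] {a b c d : L}

theorem WellInside.le (h : WellInside a b) : a ≤ b := by
  have h' := congrArg (a ⊓ ·) (show aᶜ ⊔ b = ⊤ from h)
  have : a = a ⊓ b := by simpa [inf_sup_left] using h'.symm
  rw [this]
  exact inf_le_right

theorem WellInside.mono (hab : a ≤ b) (h : WellInside b c) (hcd : c ≤ d) : WellInside a d :=
  eq_top_iff.2 (h.ge.trans (sup_le_sup (compl_le_compl hab) hcd))

theorem WellInside.compl_compl (h : WellInside a b) : WellInside aᶜᶜ b := by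
  rw [WellInside, compl_compl_compl]
  exact h

theorem WellInside.bot : WellInside (⊥ : L) b := by simp [WellInside]

theorem WellInside.top : WellInside a (⊤ : L) := by simp [WellInside]

theorem WellInside.sup (h : WellInside a c) (h' : WellInside b c) : WellInside (a ⊔ b) c := by
  unfold WellInside at *
  rw [compl_sup, sup_inf_right, h, h', inf_top_eq]

theorem WellInside.inf (h : WellInside a b) (h' : WellInside a c) : WellInside a (b ⊓ c) := by
  unfold WellInside at *
  rw [sup_inf_left, h, h', inf_top_eq]

theorem WellInside.compl (h : WellInside a b) : WellInside bᶜ aᶜ :=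
  eq_top_iff.2 (by
    rw [← show aᶜ ⊔ b = ⊤ from h, sup_comm]
    exact sup_le_sup le_compl_compl le_rfl)

end WellInside

/-- The relation `b 𝔅(□) a ↔ b ≺ □ a` between booleanizations. (`Heyting.Regular L` is the
boolean algebra of all `a : L` with `aᶜᶜ = a`.) -/
def boolRel {L M : Type u} [Order.Frame L] [Order.Frame M] (f : PreframeHom L M) :
    Heyting.Regular M → Heyting.Regular L → Prop :=
  fun b a => WellInside (b : M) (f.toFun a)

theorem boolRel_isSubordination {L M : Type u} [Order.Frame L] [Order.Frame M]
    (f : PreframeHom L M) : IsSubordination (boolRel f) where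
  bot_bot := WellInside.bot
  top_top := by
    have h : f.toFun ((⊤ : Heyting.Regular L) : L) = ⊤ := f.map_top
    rw [boolRel, h]
    exact WellInside.top
  sup_left := fun h h' => by
    rw [boolRel, Heyting.Regular.coe_sup]
    exact (WellInside.sup h h').compl_compl
  inf_right := fun {a c d} h h' => by
    have hi : WellInside (a : M) (f.toFun c ⊓ f.toFun d) := WellInside.inf h h'
    rw [← f.map_inf] at hi
    exact hi
  mono := fun h h' h'' => WellInside.mono h h' (f.monotone h'')

/-- If `b ≺ □ a` then `b ≺ □ c` for some regular `c ≺ a`. -/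
theorem interpolate {L M : KRFrmP.{u}} (f : PreframeHom L.carrier M.carrier)
    {b : M.carrier} {a : L.carrier} (h : WellInside b (f.toFun a)) :
    ∃ c : Heyting.Regular L.carrier, WellInside b (f.toFun c) ∧ WellInside (c : L.carrier) a := by
  let s : Set L.carrier := {x | WellInside x a}
  have hs : s.Nonempty := ⟨⊥, WellInside.bot⟩
  have hd : DirectedOn (· ≤ ·) s := fun x hx y hy =>
    ⟨x ⊔ y, WellInside.sup hx hy, le_sup_left, le_sup_right⟩
  have hfa : f.toFun a = sSup (f.toFun '' s) := by
    rw [← f.map_sSup s hs hd, ← L.regular a]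
  let t : Set M.carrier := (fun x => bᶜ ⊔ f.toFun x) '' s
  have ht : DirectedOn (· ≤ ·) t := by
    rintro _ ⟨x, hx, rfl⟩ _ ⟨y, hy, rfl⟩
    obtain ⟨z, hz, hxz, hyz⟩ := hd x hx y hy
    exact ⟨_, ⟨z, hz, rfl⟩, sup_le_sup_left (f.monotone hxz) _,
      sup_le_sup_left (f.monotone hyz) _⟩
  have htop : ⊤ ≤ sSup t := by
    rw [← show bᶜ ⊔ f.toFun a = ⊤ from h, hfa]
    apply sup_le
    · obtain ⟨x, hx⟩ := hs
      exact le_trans le_sup_left (le_sSup (show bᶜ ⊔ f.toFun x ∈ t from ⟨x, hx, rfl⟩))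
    · apply sSup_le
      rintro _ ⟨x, hx, rfl⟩
      exact le_trans le_sup_right (le_sSup (show bᶜ ⊔ f.toFun x ∈ t from ⟨x, hx, rfl⟩))
  obtain ⟨_, ⟨x, hx, rfl⟩, hx'⟩ := M.compact t _ (hs.image _) ht (isLUB_sSup t) htop
  refine ⟨⟨xᶜᶜ, Heyting.isRegular_compl _⟩, ?_, ?_⟩
  · exact WellInside.mono le_rfl (top_le_iff.1 hx') (f.monotone le_compl_compl)
  · exact WellInside.compl_compl hx

/-- If `b ≺ a` then `b ≺ c ≺ a` for some regular `c`. -/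
theorem interpolate_id {L : KRFrmP.{u}} {a b : L.carrier} (h : WellInside b a) :
    ∃ c : Heyting.Regular L.carrier, WellInside b c ∧ WellInside (c : L.carrier) a :=
  interpolate (M := L) ⟨id, rfl, fun _ _ => rfl, fun s _ _ => by simp⟩ h

/-- The booleanization of a compact regular frame, with the restriction of the well-inside
relation. -/
def boolObj (L : KRFrmP.{u}) : SubS5.{u} where
  carrier := Heyting.Regular L.carrier
  rel b a := WellInside (b : L.carrier) a
  isS5 :=
    { boolRel_isSubordination
        (⟨id, rfl, fun _ _ => rfl, fun s _ _ => by simp⟩ :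
          PreframeHom L.carrier L.carrier) with
      le_of_rel := fun h => WellInside.le h
      compl := fun h => WellInside.compl h
      dense := fun h => interpolate_id h }

theorem boolObj_isDeVries (L : KRFrmP.{u}) : IsDeVries (boolObj L) := by
  constructor
  · intro (s : Set (Heyting.Regular L.carrier))
    let j : L.carrier := sSup (Heyting.Regular.val '' s)
    refine ⟨(⟨jᶜᶜ, Heyting.isRegular_compl _⟩ : Heyting.Regular L.carrier), ?_, ?_⟩
    · intro a ha
      have h : Heyting.Regular.val a ≤ j := le_sSup (Set.mem_image_of_mem _ ha)
      exact (h.trans le_compl_compl : Heyting.Regular.val a ≤ jᶜᶜ)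
    · intro (b : Heyting.Regular L.carrier) hb
      have h : j ≤ Heyting.Regular.val b := by
        apply sSup_le
        rintro _ ⟨a, ha, rfl⟩
        exact hb ha
      have h' : jᶜᶜ ≤ (Heyting.Regular.val b)ᶜᶜ := compl_le_compl (compl_le_compl h)
      exact (h'.trans b.2.le : jᶜᶜ ≤ Heyting.Regular.val b)
  · intro (a : Heyting.Regular L.carrier) ha
    by_contra! hcon
    apply ha
    have h0 : Heyting.Regular.val a ≤ ⊥ := by
      rw [L.regular (Heyting.Regular.val a)]
      apply sSup_le
      intro x hx
      by_contra hx0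
      refine hcon (⟨xᶜᶜ, Heyting.isRegular_compl _⟩ : Heyting.Regular L.carrier) ?_
        (WellInside.compl_compl hx)
      intro h
      apply hx0
      have h' : xᶜᶜ = ⊥ := congrArg Heyting.Regular.val h
      exact le_compl_compl.trans h'.le
    exact Heyting.Regular.coe_injective (le_bot_iff.1 h0)

/-- The contravariant booleanization functor `𝔅`. -/
def Booleanization : KRFrmP.{u}ᵒᵖ ⥤ DeVS.{u} where
  obj L := ⟨boolObj L.unop, boolObj_isDeVries L.unop⟩
  map {X Y} f := ObjectProperty.homMk
    { rel := boolRel (L := Y.unop.carrier) (M := X.unop.carrier) f.unop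
      isSub := boolRel_isSubordination _
      comp_right := by
        funext b a
        apply propext
        constructor
        · rintro ⟨c, hbc, hca⟩
          exact WellInside.mono le_rfl hbc (PreframeHom.monotone _ (WellInside.le hca))
        · exact fun h => interpolate (L := Y.unop) (M := X.unop) f.unop h
      comp_left := by
        funext b a
        apply propext
        constructor
        · rintro ⟨c, hbc, hca⟩
          exact WellInside.mono (WellInside.le hbc) hca le_rfl
        · exact fun h => interpolate_id (L := X.unop) h }
  map_id X := by
    apply ObjectProperty.hom_ext
    apply SubS5.Hom.ext
    rfl
  map_comp {X Y Z} f g := by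
    apply ObjectProperty.hom_ext
    apply SubS5.Hom.ext
    funext c a
    apply propext
    constructor
    · intro h
      obtain ⟨b, hb, hba⟩ := interpolate (L := Y.unop) (M := X.unop) f.unop h
      exact ⟨b, hb, hba⟩
    · rintro ⟨b, hcb, hba⟩
      exact WellInside.mono le_rfl hcb (PreframeHom.monotone _ (WellInside.le hba))

/-- The MacNeille completion functor `NI = 𝔅 ∘ RI`. -/
def NI : SubS5.{u} ⥤ DeVS.{u} := RI ⋙ Booleanization

/-- The underlying round ideal of an element of `NI(B)`. -/
def NI.toRoundIdeal {B : SubS5.{u}} (I : (NI.obj B).obj.carrier) : RoundIdeal B :=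
  Heyting.Regular.val (α := RoundIdeal B) I

/-- The relation `Q_B` between `B` and `NI(B)`: `a Q_B I` iff `a ∈ I`. -/
def Q (B : SubS5.{u}) (a : B.carrier) (I : (NI.obj B).obj.carrier) : Prop :=
  a ∈ NI.toRoundIdeal I

end SubordinationAlgebra

/-! A morphism is a relation whose identities are `S` and `≺`, so `Q_B` can be invertible without
being a bijection. Write `↓b` for the round ideal `below b`. The candidate inverse relates `I` to
`b` when `I ≺ ↓b`, and two interpolation facts make it work: (1) if `a ∈ J`, some regular round
ideal `I` satisfies `a ∈ I ≺ J` (`exists_regular_wellInside`); (2) if `I ≺ J`, then already `I ≺ ↓b`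
for some `b ∈ J` (`exists_wellInside_below`). By (1) with `J = ↓b`, going to `NI(B)` and back
relates `a` to `b` iff `a ∈ ↓b`, that is, iff `a S b`. By (2), the other composite relates `I` to
`J` iff `I ≺ J`. Fact (1) also gives naturality. Neither completeness nor the de Vries density
condition on `B` is used, so the same `Q_B` serves both unit isomorphisms. -/

namespace SubordinationAlgebra

/-! ### The well-inside relation between round ideals -/

namespace RoundIdeal

variable {B : SubS5.{u}}

/-- The round ideal of all `a` with `a S b`. -/
def below (b : B.carrier) : RoundIdeal B where
  ideal := preimageIdeal B.isS5.toIsSubordination (Order.Ideal.principal b)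
  round := by
    rintro y ⟨z, hz, hyz⟩
    obtain ⟨w, hyw, hwz⟩ := B.isS5.dense hyz
    exact ⟨w, ⟨z, hz, hwz⟩, hyw⟩

theorem mem_below {a b : B.carrier} : a ∈ below b ↔ B.rel a b :=
  ⟨fun ⟨_, hz, h⟩ => B.isS5.mono le_rfl h hz, fun h => ⟨b, le_refl b, h⟩⟩

theorem below_le {b : B.carrier} {I : RoundIdeal B} (hb : b ∈ I) : below b ≤ I :=
  fun _ ha => lower (B.isS5.le_of_rel (mem_below.1 ha)) hb

/-- A common element of `below aᶜ` and `below a` lies under both `aᶜ` and `a`, so `below aᶜ` is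
contained in the pseudocomplement of `below a`. Contraposition of `S` puts `bᶜ` into `below aᶜ`. -/
theorem compl_mem_compl_below {a b : B.carrier} (h : B.rel a b) : bᶜ ∈ (below a)ᶜ := by
  have h1 : below aᶜ ≤ (below a)ᶜ := by
    rw [le_compl_iff_disjoint_right, disjoint_iff_inf_le]
    rintro y ⟨hy, hy'⟩
    have h : y ≤ ⊥ := by
      rw [← inf_compl_eq_bot (a := a)]
      exact le_inf (B.isS5.le_of_rel (mem_below.1 hy')) (B.isS5.le_of_rel (mem_below.1 hy))
    exact lower h (bot_mem _)
  exact h1 (mem_below.2 (B.isS5.compl h))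

/-- Joins of round ideals are joins of ideals, so `Iᶜ ⊔ J = ⊤` amounts to `x ⊔ y = ⊤` with `x ∈ Iᶜ`
and `y ∈ J`; then `yᶜ ≤ x`. A cover in the frame is thus witnessed by a single element of `B`. -/
theorem wellInside_iff {I J : RoundIdeal B} : WellInside I J ↔ ∃ y ∈ J, yᶜ ∈ Iᶜ := by
  constructor
  · intro h
    -- The join is written as `sSup` of a pair because the underlying ideal of `sSup` is known by
    -- definition.
    have htop : (⊤ : B.carrier) ∈ sSup {Iᶜ, J} := by
      rw [sSup_pair, show Iᶜ ⊔ J = ⊤ from h]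
      exact mem_top _
    have hle : sSup (ideal '' {Iᶜ, J}) ≤ (Iᶜ).ideal ⊔ J.ideal := by
      apply sSup_le
      rintro _ ⟨K, rfl | rfl, rfl⟩
      exacts [le_sup_left, le_sup_right]
    obtain ⟨x, hx, y, hy, hxy⟩ := Order.Ideal.mem_sup.1 (hle htop)
    refine ⟨y, hy, lower ?_ (mem_def.2 hx)⟩
    exact codisjoint_iff_compl_le_left.1 (codisjoint_iff_le_sup.2 hxy)
  · rintro ⟨y, hy, hy'⟩
    rw [WellInside, eq_top_iff]
    intro a _
    have h1 : yᶜ ∈ Iᶜ ⊔ J := (le_sup_left : Iᶜ ≤ Iᶜ ⊔ J) hy'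
    have h2 : y ∈ Iᶜ ⊔ J := (le_sup_right : J ≤ Iᶜ ⊔ J) hy
    exact lower (le_top.trans (sup_compl_eq_top (x := y)).ge) (sup_mem h2 h1)

theorem wellInside_below {a b : B.carrier} {I : RoundIdeal B} (hab : B.rel a b) (hb : b ∈ I) :
    WellInside (below a) I :=
  wellInside_iff.2 ⟨b, hb, compl_mem_compl_below hab⟩

/-- The witness `y ∈ J` of `I ≺ J` satisfies `y S b` for some `b ∈ J` by roundness, so it also
witnesses `I ≺ below b`. -/
theorem exists_wellInside_below {I J : RoundIdeal B} (h : WellInside I J) :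
    ∃ b ∈ J, WellInside I (below b) := by
  obtain ⟨y, hy, hy'⟩ := wellInside_iff.1 h
  obtain ⟨b, hb, hyb⟩ := J.round y hy
  exact ⟨b, hb, wellInside_iff.2 ⟨y, mem_below.2 hyb, hy'⟩⟩

theorem exists_regular_wellInside {a : B.carrier} {J : RoundIdeal B} (ha : a ∈ J) :
    ∃ I : Heyting.Regular (RoundIdeal B), a ∈ (I : RoundIdeal B) ∧
      WellInside (I : RoundIdeal B) J := by
  -- Roundness is used twice: `a S b` puts `a` in `below b`, and `b S c` puts `below b` well inside
  -- `J`. The double pseudocomplement then gives regularity and stays well inside `J`.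
  obtain ⟨b, hb, hab⟩ := J.round a ha
  obtain ⟨c, hc, hbc⟩ := J.round b hb
  exact ⟨⟨(below b)ᶜᶜ, Heyting.isRegular_compl _⟩,
    (le_compl_compl : below b ≤ _) (mem_below.2 hab), (wellInside_below hbc hc).compl_compl⟩

end RoundIdeal

/-! ### The isomorphism between an algebra and its MacNeille completion -/

open RoundIdeal

/-- The relation `Q_B` as a compatible subordination. -/
def Q.hom (B : SubS5.{u}) : B ⟶ (NI.obj B).obj where
  rel := Q B
  isSub :=
    { bot_bot := RoundIdeal.bot_mem _
      top_top := RoundIdeal.mem_top _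
      sup_left := fun h h' => RoundIdeal.sup_mem h h'
      inf_right := fun h h' => ⟨h, h'⟩
      mono := fun hab hb hIJ => RoundIdeal.lower hab
        ((show NI.toRoundIdeal _ ≤ NI.toRoundIdeal _ from hIJ) hb) }
  comp_right := by
    funext a J
    apply propext
    constructor
    · rintro ⟨I, haI, hIJ⟩
      exact (WellInside.le hIJ : NI.toRoundIdeal I ≤ NI.toRoundIdeal J) haI
    · exact fun h => exists_regular_wellInside h
  comp_left := by
    funext a I
    apply propext
    constructor
    · rintro ⟨b, hab, hb⟩
      exact RoundIdeal.lower (B.isS5.le_of_rel hab) hb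
    · intro h
      obtain ⟨b, hb, hab⟩ := RoundIdeal.round _ a h
      exact ⟨b, hab, hb⟩

/-- The inverse of `Q_B`: it relates `I` to `b` iff `I` is well inside the round ideal of all `a`
with `a S b`. -/
def Q.inv (B : SubS5.{u}) : (NI.obj B).obj ⟶ B where
  rel I b := WellInside (NI.toRoundIdeal I) (below b)
  isSub :=
    { bot_bot := WellInside.bot
      -- The witness is `⊤`: it lies in `below ⊤` since `1 S 1`, and its complement `⊥` lies in
      -- every ideal.
      top_top := wellInside_iff.2 ⟨⊤, mem_below.2 B.isS5.top_top, by
        rw [compl_top]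
        exact RoundIdeal.bot_mem _⟩
      sup_left := fun {I J b} h h' => by
        -- The join of regular elements is the double pseudocomplement of their join in the frame.
        have hs : NI.toRoundIdeal (I ⊔ J) = (NI.toRoundIdeal I ⊔ NI.toRoundIdeal J)ᶜᶜ :=
          Heyting.Regular.coe_sup (α := RoundIdeal B) I J
        rw [hs]
        exact (WellInside.sup h h').compl_compl
      inf_right := fun h h' => WellInside.mono le_rfl (WellInside.inf h h') fun _ ha =>
        mem_below.2 (B.isS5.inf_right (mem_below.1 ha.1) (mem_below.1 ha.2))
      mono := fun hIJ h hbc => WellInside.mono hIJ h fun _ ha =>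
        mem_below.2 (B.isS5.mono le_rfl (mem_below.1 ha) hbc) }
  comp_right := by
    funext I b
    apply propext
    constructor
    · rintro ⟨c, hc, hcb⟩
      exact WellInside.mono le_rfl hc (below_le (mem_below.2 hcb))
    · intro h
      obtain ⟨c, hc, hIc⟩ := exists_wellInside_below h
      exact ⟨c, hIc, mem_below.1 hc⟩
  comp_left := by
    funext I b
    apply propext
    constructor
    · rintro ⟨J, hIJ, hJ⟩
      exact WellInside.mono (WellInside.le hIJ) hJ le_rfl
    · exact fun h => interpolate_id (L := (RI.obj B).unop) h

/-- `Q_B` is an isomorphism. -/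
def Q.iso (B : SubS5.{u}) : B ≅ (NI.obj B).obj where
  hom := Q.hom B
  inv := Q.inv B
  hom_inv_id := by
    apply SubS5.Hom.ext
    funext a b
    apply propext
    constructor
    · rintro ⟨I, ha, hI⟩
      exact mem_below.1 ((WellInside.le hI : NI.toRoundIdeal I ≤ below b) ha)
    -- The interpolant is sought inside the round ideal `below b`, which contains `a` because `a S
    -- b`.
    · exact fun h => exists_regular_wellInside (mem_below.2 h)
  inv_hom_id := by
    apply SubS5.Hom.ext
    funext I J
    apply propext
    constructor
    · rintro ⟨b, hI, hb⟩
      exact WellInside.mono le_rfl hI (below_le hb)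
    · intro h
      obtain ⟨b, hb, hI⟩ := exists_wellInside_below (I := NI.toRoundIdeal I) h
      exact ⟨b, hI, hb⟩

/-- Both composites relate `a` to `J` exactly when `a ∈ T⁻¹[J]`. On the right, `NI(T)` relates `I`
to `J` iff `I ≺ T⁻¹[J]`, and such a regular `I` containing `a` exists by interpolation. -/
theorem Q.naturality {B₁ B₂ : SubS5.{u}} (T : B₁ ⟶ B₂) :
    T ≫ Q.hom B₂ = Q.hom B₁ ≫ (NI.map T).hom := by
  apply SubS5.Hom.ext
  funext a J
  apply propext
  constructor
  · rintro ⟨b, hab, hb⟩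
    exact exists_regular_wellInside (J := preimage T (NI.toRoundIdeal J)) ⟨b, hb, hab⟩
  · rintro ⟨I, ha, hI⟩
    obtain ⟨b, hb, hab⟩ :=
      (WellInside.le hI : NI.toRoundIdeal I ≤ preimage T (NI.toRoundIdeal J)) ha
    exact ⟨b, hab, hb⟩

/-! ### The natural isomorphisms and the equivalence -/

/-- The natural isomorphism `1 ≅ Δ ∘ NI` with components `Q_B`. -/
def unitIso : 𝟭 SubS5.{u} ≅ NI ⋙ Δ :=
  NatIso.ofComponents Q.iso Q.naturality

/-- The natural isomorphism `1 ≅ NI ∘ Δ` with components `Q_B`. -/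
def deVriesUnitIso : 𝟭 DeVS.{u} ≅ Δ ⋙ NI :=
  -- The subcategory is full, so `Q_B` and its inverse, as well as the naturality squares, lift
  -- unchanged.
  NatIso.ofComponents (fun B => IsDeVries.isoMk (Q.iso B.obj))
    fun T => ObjectProperty.hom_ext _ (Q.naturality T.hom)

end SubordinationAlgebra

theorem mainTheorem1 :
    (∃ η : 𝟭 SubordinationAlgebra.SubS5.{u} ≅
        SubordinationAlgebra.NI ⋙ SubordinationAlgebra.Δ,
      ∀ B : SubordinationAlgebra.SubS5.{u},
        (η.hom.app B).rel = SubordinationAlgebra.Q B) ∧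
    (∃ η' : 𝟭 SubordinationAlgebra.DeVS.{u} ≅
        SubordinationAlgebra.Δ ⋙ SubordinationAlgebra.NI,
      ∀ B : SubordinationAlgebra.DeVS.{u},
        (η'.hom.app B).hom.rel = SubordinationAlgebra.Q B.obj) ∧
    (∃ e : SubordinationAlgebra.SubS5.{u} ≌ SubordinationAlgebra.DeVS.{u},
      e.functor = SubordinationAlgebra.NI ∧ e.inverse = SubordinationAlgebra.Δ) :=
  ⟨⟨SubordinationAlgebra.unitIso, fun _ => rfl⟩,
    ⟨SubordinationAlgebra.deVriesUnitIso, fun _ => rfl⟩,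
    ⟨CategoryTheory.Equivalence.mk SubordinationAlgebra.NI SubordinationAlgebra.Δ
      SubordinationAlgebra.unitIso SubordinationAlgebra.deVriesUnitIso.symm, rfl, rfl⟩⟩
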